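/- For probability measures $P,Q$ on a measurable space, let $T(P,Q)(\alpha)=\inf\{\int(1-\phi)\,dQ : \phi \text{ measurable with values in } [0,1],\ \int\phi\,dP\le\alpha\}$ be the trade-off function (infimum over possibly randomized rejection rules $\phi$), and let $\mathrm{ID}(\alpha)=1-\alpha$. Setting. Let $n\ge 1$, $N\ge 1$, $C>0$, $\sigma>0$, $q\in[0,1]$. Let $D=\{d_1,\dots,d_N\}$ and $D'=D\cup\{d_{N+1}\}$ be neighbouring datasets, let $g_i\in\mathbb R^n$ be the information vector (gradient) computed from $d_i$, let $\bar g_i=g_i/\max(1,\|g_i\|_2/C)$ be the clipped vector, and let $G\sim\mathcal N(0,\sigma^2C^2\mathbb I_n)$. For $B\subseteq\{1,\dots,N\}$ put $P(B)=q^{|B|}(1-q)^{N-|B|}$ and $S_B=\sum_{i\in B}\bar g_i$, and define the laws on $\mathbb R^n$ $$P_{B}^1=P_B^2=Q_B^1=\mathrm{Law}\Big(\tfrac{S_B+G}{\max(|B|,1)}\Big),\qquad Q_{B}^2=\mathrm{Law}\Big(\tfrac{S_B+\bar g_{N+1}+G}{|B|+1}\Big),$$ with weights $w_B^1=(1-q)P(B)$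 and $w_B^2=qP(B)$. These are the output laws, on $D$ and on $D'$, of the batch-averaged subsampled Gaussian mechanism (ASGM: each record is sampled independently with probability $q$, and the noisy sum of the clipped vectors of the sampled batch is divided by the size of the batch, or by $1$ if the batch is empty) given the batch $B$ sampled from $D$ and given whether $d_{N+1}$ is not selected (superscript $1$) or selected (superscript $2$). The per-pair ASGM guarantee is $$f=T\big((P_I\mid I,\,I),\,(Q_I\mid I,\,I)\big),$$ the trade-off function of the joint laws of output and index $I=(B,j)$, where $\Pr[I=(B,j)]=w_B^j$ and, given $I=(B,j)$, the output has law $P_B^j$, respectively $Q_B^j$. Theorem. (i) For all $t\ge 0$ and $c\in[0,1]$, with $$\alpha_B^j(t,c)=\Pr_{X\sim P_B^j}\Big[\tfrac{dQ_B^j}{dP_B^j}(X)>t\Big]+c\,\Pr_{X\sim P_B^j}\Big[\tfrac{dQ_B^j}{dP_B^j}(X)=t\Big],\qquad \alpha(t,c)=\sum_{B,j}w_B^j\,\alpha_B^j(t,c),$$ one has $$f(\alpha(t,c))=\sum_{B\subseteq\{1,\dots,N\}}P(B)\Big[(1-q)\,T(P_B^1,Q_B^1)(\alpha_B^1(t,c))+q\,T(P_B^2,Q_B^2)(\alpha_B^2(t,c))\Big].$$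 (ii) For every $\alpha\in[0,1]$, $f(\alpha)\le\overline f(\alpha)$, where $$\overline f=\big(q-q(1-q)^N\big)\,T\big(P^{\otimes(n-1)},Q_N^{\otimes(n-1)}\big)+\big(1-q+q(1-q)^N\big)\,\mathrm{ID},$$ $P=\mathcal N(0,1)$ and $Q_N=\mathcal N\big(0,(\tfrac N{N+1})^2\big)$ (for $n=1$ the products are the point mass on the one-point space $\mathbb R^0$). -/

import Mathlib

open MeasureTheory ProbabilityTheory
open scoped ENNReal NNReal

noncomputable section

namespace ASGM

/-- The trade-off function `T(P, Q)(α)`: the infimum of the type II errors `∫ (1 - φ) dQ` over all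
(measurable, possibly randomized) rejection rules `φ` whose type I error `∫ φ dP` is at most `α`.
The number `φ y` is the probability of rejecting the null hypothesis on observing `y`. -/
def tradeoff {Y : Type*} [MeasurableSpace Y] (P Q : Measure Y) (α : ℝ) : ℝ :=
  sInf {β : ℝ | ∃ φ : Y → ℝ, Measurable φ ∧ (∀ y, φ y ∈ Set.Icc (0 : ℝ) 1) ∧
    ∫ y, φ y ∂P ≤ α ∧ β = ∫ y, (1 - φ y) ∂Q}

/-- The identical trade-off function. -/
def idTradeoff (α : ℝ) : ℝ := 1 - α

/-- The type I error, in testing `P` against `Q`, of the likelihood ratio test which rejects when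
`dQ/dP > t` and rejects with probability `c` when `dQ/dP = t`. -/
def lrLevel {Y : Type*} [MeasurableSpace Y] (P Q : Measure Y) (t : ℝ≥0) (c : ℝ) : ℝ :=
  P.real {x | (t : ℝ≥0∞) < Q.rnDeriv P x} + c * P.real {x | Q.rnDeriv P x = (t : ℝ≥0∞)}

/-- The joint law of `(X, I)` where `I = i` with probability `w i` and, given `I = i`,
`X` has law `P i`. -/
def revealed {ι Y : Type*} [Fintype ι] [MeasurableSpace ι] [MeasurableSpace Y]
    (w : ι → ℝ) (P : ι → Measure Y) : Measure (Y × ι) :=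
  ∑ i, ENNReal.ofReal (w i) • (P i).map (fun x => (x, i))

/-- The distribution `P = N(0, 1)`. -/
def stdNormal : Measure ℝ := gaussianReal 0 1

/-- The distribution `Q_x = N(0, (x / (x + 1))²)`. -/
def scaledNormal (x : ℕ) : Measure ℝ := gaussianReal 0 (((x : ℝ≥0) / ((x : ℝ≥0) + 1)) ^ 2)

/-- The product distribution `μ^{⊗k}`. -/
def tensorPow (μ : Measure ℝ) (k : ℕ) : Measure (Fin k → ℝ) := Measure.pi fun _ => μ

/-- Clipping to norm at most `C`. -/
def clip {n : ℕ} (C : ℝ) (v : EuclideanSpace ℝ (Fin n)) : EuclideanSpace ℝ (Fin n) :=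
  (max 1 (‖v‖ / C))⁻¹ • v

/-- The law of `(s + G) / k`, where `G ∼ N(0, σ² C² I)`; the normalization factor is `1` if
`k = 0`. With `s` the sum of the clipped vectors of a batch of size `k`, this is the law of the
output of the batch-averaged subsampled Gaussian mechanism given that batch. -/
def batchOutput {n : ℕ} (C σ : ℝ) (s : EuclideanSpace ℝ (Fin n)) (k : ℕ) :
    Measure (EuclideanSpace ℝ (Fin n)) :=
  (stdGaussian (EuclideanSpace ℝ (Fin n))).map
    (fun z => ((max k 1 : ℕ) : ℝ)⁻¹ • (s + (σ * C) • z))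

/-- The revealed index: the batch `B ⊆ {1, …, N}` sampled from the common records, and whether the
additional record (present only in `D'`) is selected. -/
abbrev Index (N : ℕ) : Type := Finset (Fin N) × Bool

/-- The probability `P(B) (1 - q)` or `P(B) q` of an index, `P(B) = q^|B| (1 - q)^(N - |B|)`. -/
def weight {N : ℕ} (q : ℝ) (i : Index N) : ℝ :=
  q ^ i.1.card * (1 - q) ^ (N - i.1.card) * (if i.2 then q else 1 - q)

/-- The law of the output on `D` given the index. -/
def compD {𝒳 : Type*} {n N : ℕ} (C σ : ℝ) (g : 𝒳 → EuclideanSpace ℝ (Fin n)) (D : Fin N → 𝒳)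
    (i : Index N) : Measure (EuclideanSpace ℝ (Fin n)) :=
  batchOutput C σ (∑ j ∈ i.1, clip C (g (D j))) i.1.card

/-- The law of the output on `D' = D ∪ {d}` given the index. -/
def compD' {𝒳 : Type*} {n N : ℕ} (C σ : ℝ) (g : 𝒳 → EuclideanSpace ℝ (Fin n)) (D : Fin N → 𝒳)
    (d : 𝒳) (i : Index N) : Measure (EuclideanSpace ℝ (Fin n)) :=
  if i.2 then batchOutput C σ (∑ j ∈ i.1, clip C (g (D j)) + clip C (g d)) (i.1.card + 1)
  else batchOutput C σ (∑ j ∈ i.1, clip C (g (D j))) i.1.card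

/-- The per-pair guarantee `f` for the ordered pair `(D, D ∪ {d})`: the trade-off function
`T((P_I | I, I), (Q_I | I, I))` of the two experiments in which the index is revealed. -/
def perPairGuarantee {𝒳 : Type*} {n N : ℕ} (C σ q : ℝ) (g : 𝒳 → EuclideanSpace ℝ (Fin n))
    (D : Fin N → 𝒳) (d : 𝒳) : ℝ → ℝ :=
  tradeoff (revealed (weight q) (compD C σ g D)) (revealed (weight q) (compD' C σ g D d))

/-- The upper bound. -/
def upperBound (n N : ℕ) (q α : ℝ) : ℝ :=
  (q - q * (1 - q) ^ N) *
      tradeoff (tensorPow stdNormal (n - 1)) (tensorPow (scaledNormal N) (n - 1)) α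
    + (1 - q + q * (1 - q) ^ N) * idTradeoff α

end ASGM

end

namespace ASGM

/-! ### Tests and the Neyman–Pearson lemma. -/

section Tests

/-! Part (i) is Neyman–Pearson with one multiplier. For a threshold `t`, the likelihood ratio test
minimizes (type II error) + `t` · (type I error) in each component (`lrTest_optimal`). Once the
index is revealed, a test is a free choice of one test per index and both errors are weighted
averages. Since `t` is common to all indices, the averaged inequalities are again a Lagrangian
bound, so the combined test is optimal at its total level.

Part (ii) exhibits tests. If the extra record joins a batch of size `k ≥ 1`, the two outputs have
different means and noise scales `1/k` and `1/(k+1)`. Projecting orthogonally to the mean shift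
leaves `N(0,1)` against `Q_k` in `n - 1` coordinates, and added noise degrades this to `N(0,1)`
against `Q_N`, as `k ≤ N`. Thus one test of the latter pair serves every such index; elsewhere the
constant test `α` gives `ID`. -/

lemma one_sub_test_mem_Icc {Y : Type*} {φ : Y → ℝ} (h01 : ∀ y, φ y ∈ Set.Icc (0 : ℝ) 1) (y : Y) :
    1 - φ y ∈ Set.Icc (0 : ℝ) 1 :=
  ⟨sub_nonneg.2 (h01 y).2, sub_le_self _ (h01 y).1⟩

variable {Y : Type*} [MeasurableSpace Y]

lemma integrable_test (μ : Measure Y) [IsFiniteMeasure μ] {φ : Y → ℝ} (hφ : Measurable φ)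
    (h01 : ∀ y, φ y ∈ Set.Icc (0 : ℝ) 1) : Integrable φ μ :=
  Integrable.of_mem_Icc 0 1 hφ.aemeasurable (ae_of_all _ h01)

lemma integral_one_sub_test (μ : Measure Y) [IsProbabilityMeasure μ] {φ : Y → ℝ}
    (hφ : Measurable φ) (h01 : ∀ y, φ y ∈ Set.Icc (0 : ℝ) 1) :
    ∫ y, (1 - φ y) ∂μ = 1 - ∫ y, φ y ∂μ := by
  rw [integral_sub (integrable_const _) (integrable_test μ hφ h01)]
  simp

lemma tradeoff_le {P Q : Measure Y} {α : ℝ} {φ : Y → ℝ} (hφ : Measurable φ)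
    (h01 : ∀ y, φ y ∈ Set.Icc (0 : ℝ) 1) (hα : ∫ y, φ y ∂P ≤ α) :
    tradeoff P Q α ≤ ∫ y, (1 - φ y) ∂Q := by
  refine csInf_le ⟨0, ?_⟩ ⟨φ, hφ, h01, hα, rfl⟩
  rintro _ ⟨ψ, -, h, -, rfl⟩
  exact integral_nonneg fun y => sub_nonneg.2 (h y).2

lemma tradeoff_set_nonempty {P Q : Measure Y} {α : ℝ} (hα : 0 ≤ α) :
    {β : ℝ | ∃ φ : Y → ℝ, Measurable φ ∧ (∀ y, φ y ∈ Set.Icc (0 : ℝ) 1) ∧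
      ∫ y, φ y ∂P ≤ α ∧ β = ∫ y, (1 - φ y) ∂Q}.Nonempty :=
  ⟨_, fun _ => 0, measurable_const, by simp, by simpa using hα, rfl⟩

lemma le_tradeoff {P Q : Measure Y} {α b : ℝ} (hα : 0 ≤ α)
    (h : ∀ φ : Y → ℝ, Measurable φ → (∀ y, φ y ∈ Set.Icc (0 : ℝ) 1) → ∫ y, φ y ∂P ≤ α →
      b ≤ ∫ y, (1 - φ y) ∂Q) :
    b ≤ tradeoff P Q α := by
  refine le_csInf (tradeoff_set_nonempty hα) ?_
  rintro _ ⟨φ, hφ, h01, hle, rfl⟩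
  exact h φ hφ h01 hle

/-- The likelihood ratio test of `P` against `Q` with threshold `t`, randomized with probability
`c` on the boundary. -/
noncomputable def lrTest (P Q : Measure Y) (t : ℝ≥0) (c : ℝ) (y : Y) : ℝ :=
  {x | (t : ℝ≥0∞) < Q.rnDeriv P x}.indicator 1 y
    + {x | Q.rnDeriv P x = (t : ℝ≥0∞)}.indicator (fun _ => c) y

lemma measurable_lrTest (P Q : Measure Y) (t : ℝ≥0) (c : ℝ) : Measurable (lrTest P Q t c) :=
  (measurable_one.indicator (measurableSet_lt measurable_const (Q.measurable_rnDeriv P))).add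
    (measurable_const.indicator (Q.measurable_rnDeriv P (measurableSet_singleton _)))

lemma lrTest_of_lt {P Q : Measure Y} {t : ℝ≥0} {c : ℝ} {y : Y}
    (h : (t : ℝ≥0∞) < Q.rnDeriv P y) : lrTest P Q t c y = 1 := by
  simp [lrTest, h, h.ne']

lemma lrTest_of_gt {P Q : Measure Y} {t : ℝ≥0} {c : ℝ} {y : Y}
    (h : Q.rnDeriv P y < (t : ℝ≥0∞)) : lrTest P Q t c y = 0 := by
  simp [lrTest, h.ne, h.not_gt]

lemma lrTest_of_eq {P Q : Measure Y} {t : ℝ≥0} {c : ℝ} {y : Y}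
    (h : Q.rnDeriv P y = (t : ℝ≥0∞)) : lrTest P Q t c y = c := by
  simp [lrTest, h]

lemma lrTest_mem_Icc (P Q : Measure Y) (t : ℝ≥0) {c : ℝ} (hc : c ∈ Set.Icc (0 : ℝ) 1) (y : Y) :
    lrTest P Q t c y ∈ Set.Icc (0 : ℝ) 1 := by
  rcases lt_trichotomy (Q.rnDeriv P y) t with h | h | h
  · simp [lrTest_of_gt h]
  · rwa [lrTest_of_eq h]
  · simp [lrTest_of_lt h]

lemma integral_lrTest (P Q : Measure Y) [IsFiniteMeasure P] (t : ℝ≥0) (c : ℝ) :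
    ∫ y, lrTest P Q t c y ∂P = lrLevel P Q t c := by
  have h1 : MeasurableSet {x | (t : ℝ≥0∞) < Q.rnDeriv P x} :=
    measurableSet_lt measurable_const (Q.measurable_rnDeriv P)
  have h2 : MeasurableSet {x | Q.rnDeriv P x = (t : ℝ≥0∞)} :=
    Q.measurable_rnDeriv P (measurableSet_singleton _)
  have h3 : Integrable ({x | (t : ℝ≥0∞) < Q.rnDeriv P x}.indicator (1 : Y → ℝ)) P :=
    (integrable_const (1 : ℝ)).indicator h1
  simp only [lrTest, lrLevel]
  rw [integral_add h3 ((integrable_const c).indicator h2), integral_indicator_one h1, integral_indicator_const c h2, smul_eq_mul, mul_comm c]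

lemma lrLevel_nonneg (P Q : Measure Y) (t : ℝ≥0) {c : ℝ} (hc : 0 ≤ c) : 0 ≤ lrLevel P Q t c := by
  unfold lrLevel
  positivity

/-- The **Neyman–Pearson lemma** in Lagrangian form. -/
lemma lrTest_optimal (P Q : Measure Y) [IsProbabilityMeasure P] [IsProbabilityMeasure Q]
    (hQP : Q ≪ P) (t : ℝ≥0) {c : ℝ} (hc : c ∈ Set.Icc (0 : ℝ) 1) {φ : Y → ℝ} (hφ : Measurable φ)
    (h01 : ∀ y, φ y ∈ Set.Icc (0 : ℝ) 1) :
    ∫ y, (1 - lrTest P Q t c y) ∂Q + t * lrLevel P Q t c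
      ≤ ∫ y, (1 - φ y) ∂Q + t * ∫ y, φ y ∂P := by
  have hm := measurable_lrTest P Q t c
  have hl := lrTest_mem_Icc P Q t hc
  have hQ : 0 ≤ ∫ y, (lrTest P Q t c y - φ y) ∂Q - t * ∫ y, (lrTest P Q t c y - φ y) ∂P := by
    have hint : Integrable (fun y => lrTest P Q t c y - φ y) Q :=
      (integrable_test Q hm hl).sub (integrable_test Q hφ h01)
    have hint' : Integrable (fun y => (t : ℝ) * (lrTest P Q t c y - φ y)) P :=
      ((integrable_test P hm hl).sub (integrable_test P hφ h01)).const_mul _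
    rw [← integral_rnDeriv_smul hQP, ← integral_const_mul,
      ← integral_sub ((integrable_rnDeriv_smul_iff hQP).2 hint) hint']
    -- The integrand is `(dQ/dP - t) * (lrTest - φ)`, whose two factors never have opposite strict
    -- signs.
    refine integral_nonneg_of_ae ?_
    filter_upwards [Q.rnDeriv_lt_top P] with y hy
    have h := h01 y
    simp only [smul_eq_mul, Pi.zero_apply, ← sub_mul]
    rcases lt_trichotomy (Q.rnDeriv P y) t with hr | hr | hr
    · have := ENNReal.toReal_mono ENNReal.coe_ne_top hr.le
      rw [lrTest_of_gt hr]
      exact mul_nonneg_of_nonpos_of_nonpos (by simpa using this) (by linarith [h.1])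
    · simp [hr]
    · have := ENNReal.toReal_mono hy.ne hr.le
      rw [lrTest_of_lt hr]
      exact mul_nonneg (by simpa using this) (by linarith [h.2])
  rw [integral_sub (integrable_test Q hm hl) (integrable_test Q hφ h01),
    integral_sub (integrable_test P hm hl) (integrable_test P hφ h01), integral_lrTest] at hQ
  rw [integral_one_sub_test Q hm hl, integral_one_sub_test Q hφ h01]
  linarith

lemma tradeoff_lrLevel (P Q : Measure Y) [IsProbabilityMeasure P] [IsProbabilityMeasure Q]
    (hQP : Q ≪ P) (t : ℝ≥0) {c : ℝ} (hc : c ∈ Set.Icc (0 : ℝ) 1) :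
    tradeoff P Q (lrLevel P Q t c) = ∫ y, (1 - lrTest P Q t c y) ∂Q := by
  refine le_antisymm (tradeoff_le (measurable_lrTest P Q t c) (lrTest_mem_Icc P Q t hc)
    (integral_lrTest P Q t c).le) (le_tradeoff (lrLevel_nonneg P Q t hc.1) fun φ hφ h01 hle => ?_)
  have := lrTest_optimal P Q hQP t hc hφ h01
  have := mul_le_mul_of_nonneg_left hle t.coe_nonneg
  linarith

end Tests

/-! ### Experiments with revealed index. -/

section Revealed

variable {ι Y : Type*} [Fintype ι] [MeasurableSpace ι] [MeasurableSpace Y]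

lemma integral_revealed {w : ι → ℝ} (hw : ∀ i, 0 ≤ w i) (P : ι → Measure Y)
    [∀ i, IsProbabilityMeasure (P i)] {φ : Y × ι → ℝ} (hφ : Measurable φ)
    (h01 : ∀ y, φ y ∈ Set.Icc (0 : ℝ) 1) :
    ∫ y, φ y ∂(revealed w P) = ∑ i, w i * ∫ x, φ (x, i) ∂(P i) := by
  have hmap : ∀ i, IsProbabilityMeasure ((P i).map fun x => (x, i)) := fun i =>
    Measure.isProbabilityMeasure_map (by fun_prop)
  rw [revealed, integral_finsetSum_measure fun i _ =>
    (integrable_test _ hφ h01).smul_measure ENNReal.ofReal_ne_top]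
  refine Finset.sum_congr rfl fun i _ => ?_
  rw [integral_smul_measure, integral_map (by fun_prop) hφ.aestronglyMeasurable,
    ENNReal.toReal_ofReal (hw i), smul_eq_mul]

lemma tradeoff_revealed_le [DiscreteMeasurableSpace ι] {w : ι → ℝ} (hw : ∀ i, 0 ≤ w i) (P Q : ι → Measure Y)
    [∀ i, IsProbabilityMeasure (P i)] [∀ i, IsProbabilityMeasure (Q i)] {α : ℝ} {φ : ι → Y → ℝ}
    (hφ : ∀ i, Measurable (φ i)) (h01 : ∀ i y, φ i y ∈ Set.Icc (0 : ℝ) 1)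
    (hα : ∑ i, w i * ∫ y, φ i y ∂(P i) ≤ α) :
    tradeoff (revealed w P) (revealed w Q) α ≤ ∑ i, w i * ∫ y, (1 - φ i y) ∂(Q i) := by
  have hm : Measurable fun p : Y × ι => φ p.2 p.1 := measurable_from_prod_countable_left hφ
  refine (tradeoff_le hm (fun p => h01 _ _)
    ((integral_revealed hw P hm fun p => h01 _ _).trans_le hα)).trans_eq ?_
  exact integral_revealed hw Q (hm.const_sub 1) (one_sub_test_mem_Icc fun p => h01 _ _)

/-- At the levels of likelihood ratio tests with a common threshold, revealing the index turns
mixtures of experiments into mixtures of trade-off functions. -/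
lemma tradeoff_revealed_lrLevel [DiscreteMeasurableSpace ι] {w : ι → ℝ} (hw : ∀ i, 0 ≤ w i) (P Q : ι → Measure Y)
    [∀ i, IsProbabilityMeasure (P i)] [∀ i, IsProbabilityMeasure (Q i)] (hQP : ∀ i, Q i ≪ P i)
    (t : ℝ≥0) {c : ℝ} (hc : c ∈ Set.Icc (0 : ℝ) 1) :
    tradeoff (revealed w P) (revealed w Q) (∑ i, w i * lrLevel (P i) (Q i) t c) =
      ∑ i, w i * tradeoff (P i) (Q i) (lrLevel (P i) (Q i) t c) := by
  simp_rw [fun i => tradeoff_lrLevel (P i) (Q i) (hQP i) t hc]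
  refine le_antisymm (tradeoff_revealed_le hw P Q (fun i => measurable_lrTest _ _ t c)
    (fun i => lrTest_mem_Icc _ _ t hc) (by simp_rw [integral_lrTest]; rfl))
    (le_tradeoff (Finset.sum_nonneg fun i _ => mul_nonneg (hw i) (lrLevel_nonneg _ _ t hc.1))
      fun φ hφ h01 hle => ?_)
  rw [integral_revealed hw P hφ h01] at hle
  rw [integral_revealed hw Q (hφ.const_sub 1) (one_sub_test_mem_Icc h01)]
  -- The multiplier `t` does not depend on `i`, so it factors out of the weighted sum and meets the
  -- single constraint on the total level.
  have key := Finset.sum_le_sum fun i (_ : i ∈ Finset.univ) =>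
    mul_le_mul_of_nonneg_left (lrTest_optimal (P i) (Q i) (hQP i) t hc
      (φ := fun x => φ (x, i)) (hφ.comp (by fun_prop)) fun x => h01 _) (hw i)
  simp_rw [mul_add, Finset.sum_add_distrib, mul_left_comm _ (t : ℝ), ← Finset.mul_sum] at key
  have := mul_le_mul_of_nonneg_left hle t.coe_nonneg
  linarith

end Revealed

end ASGM

namespace ASGM

/-! ### Images of product measures. -/

section Pi

lemma pi_absolutelyContinuous {X : Type*} [MeasurableSpace X] {n : ℕ} {μ ν : Fin n → Measure X}
    [∀ i, SigmaFinite (μ i)] [∀ i, SigmaFinite (ν i)] (h : ∀ i, μ i ≪ ν i) :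
    Measure.pi μ ≪ Measure.pi ν := by
  induction n with
  | zero => rw [Subsingleton.elim μ ν]
  | succ n ih =>
    rw [← ((measurePreserving_piFinSuccAbove μ 0).symm _).map_eq,
      ← ((measurePreserving_piFinSuccAbove ν 0).symm _).map_eq]
    exact ((h 0).prod (ih fun i => h _)).map (MeasurableEquiv.measurable _)

lemma tensorPow_map (μ : Measure ℝ) [IsProbabilityMeasure μ] {f : ℝ → ℝ} (hf : Measurable f)
    (m : ℕ) : (tensorPow μ m).map (fun x i => f (x i)) = tensorPow (μ.map f) m := by
  have := Measure.isProbabilityMeasure_map (μ := μ) hf.aemeasurable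
  exact Measure.pi_map_pi fun _ => hf.aemeasurable

lemma tensorPow_map_tail (μ : Measure ℝ) [IsProbabilityMeasure μ] (m : ℕ) :
    (tensorPow μ (m + 1)).map (fun x (i : Fin m) => x i.succ) = tensorPow μ m := by
  have h := (measurePreserving_piFinSuccAbove (fun _ : Fin (m + 1) => μ) 0).map_eq
  have h2 := congrArg (Measure.map Prod.snd) h
  rw [Measure.map_map measurable_snd (MeasurableEquiv.measurable _), Measure.map_snd_prod] at h2
  simp only [measure_univ, one_smul] at h2
  exact h2

lemma tensorPow_prod_map (μ ν : Measure ℝ) [IsProbabilityMeasure μ] [IsProbabilityMeasure ν]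
    {f : ℝ × ℝ → ℝ} (hf : Measurable f) (m : ℕ) :
    ((tensorPow μ m).prod (tensorPow ν m)).map (fun p i => f (p.1 i, p.2 i)) =
      tensorPow ((μ.prod ν).map f) m := by
  have := Measure.isProbabilityMeasure_map (μ := μ.prod ν) hf.aemeasurable
  have h := measurePreserving_arrowProdEquivProdArrow ℝ ℝ (Fin m) (fun _ => μ) fun _ => ν
  unfold tensorPow
  rw [← h.map_eq, Measure.map_map (by fun_prop) h.measurable]
  exact Measure.pi_map_pi fun _ => hf.aemeasurable

end Pi

/-! ### One-dimensional Gaussians and added noise. -/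

section Gaussian

instance : IsProbabilityMeasure stdNormal := by unfold stdNormal; infer_instance

instance (x : ℕ) : IsProbabilityMeasure (scaledNormal x) := by unfold scaledNormal; infer_instance

instance (μ : Measure ℝ) [IsProbabilityMeasure μ] (m : ℕ) :
    IsProbabilityMeasure (tensorPow μ m) := by unfold tensorPow; infer_instance

lemma gaussianReal_prod_map_add (a b : ℝ) (v w : ℝ≥0) :
    ((gaussianReal 0 v).prod (gaussianReal 0 w)).map (fun p => a * p.1 + b * p.2) =
      gaussianReal 0 (.mk (a ^ 2) (sq_nonneg _) * v + .mk (b ^ 2) (sq_nonneg _) * w) := by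
  have h := gaussianReal_conv_gaussianReal (m₁ := a * 0) (m₂ := b * 0)
    (v₁ := .mk (a ^ 2) (sq_nonneg _) * v) (v₂ := .mk (b ^ 2) (sq_nonneg _) * w)
  rw [← gaussianReal_map_const_mul, ← gaussianReal_map_const_mul, Measure.conv,
    Measure.map_prod_map _ _ (by fun_prop) (by fun_prop),
    Measure.map_map (by fun_prop) (by fun_prop)] at h
  simpa [Function.comp_def] using h

lemma stdNormal_map_mul (x : ℕ) :
    stdNormal.map (((x : ℝ) / (x + 1)) * ·) = scaledNormal x := by
  rw [stdNormal, gaussianReal_map_const_mul, scaledNormal]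
  congr 1
  · simp
  · ext; simp

/-- Adding independent noise transforms the pair `(N(0, 1), Q_x)` into the pair `(N(0, 1), Q_y)`
when `x ≤ y`. -/
lemma exists_noise_coeff {x y : ℕ} (hxy : x ≤ y) :
    ∃ a b : ℝ, (stdNormal.prod stdNormal).map (fun p => a * p.1 + b * p.2) = stdNormal ∧
      ((scaledNormal x).prod stdNormal).map (fun p => a * p.1 + b * p.2) = scaledNormal y := by
  set r : ℝ := (x : ℝ) / (x + 1) with hr
  set s : ℝ := (y : ℝ) / (y + 1) with hs
  have hr0 : 0 ≤ r := by positivity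
  have hrs : r ≤ s := by
    rw [hr, hs, div_le_div_iff₀ (by positivity) (by positivity)]
    have : (x : ℝ) ≤ y := by exact_mod_cast hxy
    nlinarith
  have hs1 : s < 1 := by rw [hs, div_lt_one (by positivity)]; linarith
  have hr2 : 0 < 1 - r ^ 2 := by nlinarith
  have hs2 : 0 ≤ 1 - s ^ 2 := by nlinarith
  have hle : (1 - s ^ 2) / (1 - r ^ 2) ≤ 1 := by
    rw [div_le_one hr2]; nlinarith
  -- The coefficients solve `a² + b² = 1` and `a² r² + b² = s²`; `r ≤ s` makes `b²` nonnegative.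
  refine ⟨√((1 - s ^ 2) / (1 - r ^ 2)), √(1 - (1 - s ^ 2) / (1 - r ^ 2)), ?_, ?_⟩
  · rw [stdNormal, gaussianReal_prod_map_add]
    congr 1
    ext
    simp [Real.sq_sqrt (div_nonneg hs2 hr2.le), Real.sq_sqrt (sub_nonneg.2 hle)]
  · rw [scaledNormal, stdNormal, gaussianReal_prod_map_add, scaledNormal]
    congr 1
    ext
    simp only [NNReal.coe_add, NNReal.coe_mul, NNReal.coe_mk, NNReal.coe_pow, NNReal.coe_div,
      NNReal.coe_natCast, NNReal.coe_one, mul_one, ← hr, ← hs,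
      Real.sq_sqrt (div_nonneg hs2 hr2.le), Real.sq_sqrt (sub_nonneg.2 hle)]
    field_simp
    ring

end Gaussian

/-! ### Outputs given the batch, and their projections. -/

section BatchOutput

variable {n : ℕ}

instance (C σ : ℝ) (s : EuclideanSpace ℝ (Fin n)) (k : ℕ) :
    IsProbabilityMeasure (batchOutput C σ s k) :=
  Measure.isProbabilityMeasure_map (by fun_prop)

lemma batchOutput_eq_map_pi (C σ : ℝ) (s : EuclideanSpace ℝ (Fin n)) (k : ℕ) :
    batchOutput C σ s k =
      (Measure.pi fun i => (gaussianReal 0 1).map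
        (fun x => ((max k 1 : ℕ) : ℝ)⁻¹ * (s i + σ * C * x))).map (WithLp.toLp 2) := by
  have : ∀ i, IsProbabilityMeasure ((gaussianReal 0 1).map
      (fun x => ((max k 1 : ℕ) : ℝ)⁻¹ * (s i + σ * C * x))) := fun i =>
    Measure.isProbabilityMeasure_map (by fun_prop)
  rw [← Measure.pi_map_pi (fun i => by fun_prop), Measure.map_map (by fun_prop) (by fun_prop),
    batchOutput, ← map_pi_eq_stdGaussian, Measure.map_map (by fun_prop) (by fun_prop)]
  rfl

/-- Each coordinate is a nondegenerate Gaussian because `σ * C > 0`. This lets Neyman–Pearson write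
integrals against `Q` through `dQ/dP`, with no singular part. -/
lemma batchOutput_absolutelyContinuous {C σ : ℝ} (hC : 0 < C) (hσ : 0 < σ)
    (s s' : EuclideanSpace ℝ (Fin n)) (k k' : ℕ) :
    batchOutput C σ s k ≪ batchOutput C σ s' k' := by
  have key : ∀ (k : ℕ) (a : ℝ), ∃ (μ : ℝ) (v : ℝ≥0), v ≠ 0 ∧ (gaussianReal 0 1).map
      (fun x => ((max k 1 : ℕ) : ℝ)⁻¹ * (a + σ * C * x)) = gaussianReal μ v := by
    intro k a
    have hk : ((max k 1 : ℕ) : ℝ) ≠ 0 := by positivity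
    have hcomp : (fun x => ((max k 1 : ℕ) : ℝ)⁻¹ * (a + σ * C * x)) =
        (fun x => ((max k 1 : ℕ) : ℝ)⁻¹ * x) ∘ (fun x => a + x) ∘ (fun x => σ * C * x) := rfl
    rw [hcomp, ← Measure.map_map (by fun_prop) (by fun_prop),
      ← Measure.map_map (by fun_prop) (by fun_prop), gaussianReal_map_const_mul,
      gaussianReal_map_const_add, gaussianReal_map_const_mul]
    refine ⟨_, _, ?_, rfl⟩
    rw [← NNReal.coe_ne_zero]
    simp only [NNReal.coe_mul, NNReal.coe_mk, NNReal.coe_one]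
    positivity
  have hprob : ∀ (s : EuclideanSpace ℝ (Fin n)) (k : ℕ) (i : Fin n), IsProbabilityMeasure
      ((gaussianReal 0 1).map (fun x => ((max k 1 : ℕ) : ℝ)⁻¹ * (s i + σ * C * x))) :=
    fun s k i => Measure.isProbabilityMeasure_map (by fun_prop)
  rw [batchOutput_eq_map_pi, batchOutput_eq_map_pi]
  refine (pi_absolutelyContinuous fun i => ?_).map (by fun_prop)
  obtain ⟨μ, v, hv, h⟩ := key k (s i)
  obtain ⟨μ', v', hv', h'⟩ := key k' (s' i)
  rw [h, h']
  exact (gaussianReal_absolutelyContinuous μ hv).trans (gaussianReal_absolutelyContinuous' μ' hv')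

lemma exists_orthonormalBasis_inner_succ_eq_zero {m : ℕ} (w : EuclideanSpace ℝ (Fin (m + 1))) :
    ∃ b : OrthonormalBasis (Fin (m + 1)) ℝ (EuclideanSpace ℝ (Fin (m + 1))),
      ∀ i : Fin m, inner ℝ (b i.succ) w = 0 := by
  by_cases hw : w = 0
  · exact ⟨EuclideanSpace.basisFun _ ℝ, by simp [hw]⟩
  have hv : Orthonormal ℝ (({0} : Set (Fin (m + 1))).domRestrict fun _ => ‖w‖⁻¹ • w) := by
    refine ⟨fun i => ?_, fun i j hij => absurd (Subsingleton.elim i j) hij⟩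
    simp [norm_smul, hw]
  obtain ⟨b, hb⟩ := hv.exists_orthonormalBasis_extension_of_card_eq (by simp)
  refine ⟨b, fun i => ?_⟩
  have h0 : w = ‖w‖ • b 0 := by
    rw [hb 0 rfl, smul_smul, mul_inv_cancel₀ (norm_ne_zero_iff.2 hw), one_smul]
  rw [h0, inner_smul_right, b.inner_eq_zero (Fin.succ_ne_zero i), mul_zero]

lemma stdGaussian_map_inner_succ {m : ℕ}
    (b : OrthonormalBasis (Fin (m + 1)) ℝ (EuclideanSpace ℝ (Fin (m + 1)))) :
    (stdGaussian (EuclideanSpace ℝ (Fin (m + 1)))).map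
      (fun x (i : Fin m) => inner ℝ (b i.succ) x) = tensorPow stdNormal m := by
  rw [stdGaussian_eq_map_pi_orthonormalBasis b, Measure.map_map (by fun_prop) (by fun_prop),
    ← tensorPow_map_tail]
  congr 1
  ext x i
  simp [b.orthonormal.inner_right_fintype]

/-- A common projection, orthogonal to the shift of the means, of two outputs with batch sizes `k`
and `k + 1`. -/
lemma exists_projection {m : ℕ} {C σ : ℝ} (hC : 0 < C) (hσ : 0 < σ)
    (s s' : EuclideanSpace ℝ (Fin (m + 1))) {k : ℕ} (hk : 1 ≤ k) :
    ∃ L : EuclideanSpace ℝ (Fin (m + 1)) → Fin m → ℝ, Measurable L ∧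
      (batchOutput C σ s k).map L = tensorPow stdNormal m ∧
      (batchOutput C σ s' (k + 1)).map L = tensorPow (scaledNormal k) m := by
  have hk0 : (k : ℝ) ≠ 0 := by positivity
  have hk1 : (k : ℝ) + 1 ≠ 0 := by positivity
  obtain ⟨b, hb⟩ := exists_orthonormalBasis_inner_succ_eq_zero
    (((k : ℝ) + 1)⁻¹ • s' - (k : ℝ)⁻¹ • s)
  -- The factor standardizes the noise at batch size `k`, hence leaves `k / (k + 1)` at size `k +
  -- 1`. The centre `s / k` works for both laws, the difference of means being orthogonal to these
  -- directions.
  refine ⟨fun x i => (k : ℝ) / (σ * C) * inner ℝ (b i.succ) (x - (k : ℝ)⁻¹ • s), by fun_prop,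
    ?_, ?_⟩
  · rw [batchOutput, Measure.map_map (by fun_prop) (by fun_prop), ← stdGaussian_map_inner_succ b]
    congr 1
    ext x i
    simp only [Function.comp_apply, max_eq_left hk, smul_add, add_sub_cancel_left,
      inner_smul_right]
    field_simp
  · rw [batchOutput, Measure.map_map (by fun_prop) (by fun_prop), ← stdNormal_map_mul,
      ← tensorPow_map _ (by fun_prop), ← stdGaussian_map_inner_succ b,
      Measure.map_map (by fun_prop) (by fun_prop)]
    congr 1
    ext x i
    have hmax : ((max (k + 1) 1 : ℕ) : ℝ) = k + 1 := by simp
    simp only [Function.comp_apply, hmax, smul_add, add_sub_right_comm]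
    rw [inner_add_right, hb i]
    simp only [inner_smul_right, zero_add]
    field_simp

/-- Every test of `N(0, 1)^{⊗m}` against `Q_N^{⊗m}` is simulated, with the same errors, by a test
of two outputs with batch sizes `k ≤ N` and `k + 1`. -/
lemma exists_test_batchOutput {m N : ℕ} {C σ : ℝ} (hC : 0 < C) (hσ : 0 < σ)
    (s s' : EuclideanSpace ℝ (Fin (m + 1))) {k : ℕ} (hk : 1 ≤ k) (hkN : k ≤ N)
    {φ : (Fin m → ℝ) → ℝ} (hφ : Measurable φ) (h01 : ∀ y, φ y ∈ Set.Icc (0 : ℝ) 1) :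
    ∃ ψ : EuclideanSpace ℝ (Fin (m + 1)) → ℝ, Measurable ψ ∧ (∀ y, ψ y ∈ Set.Icc (0 : ℝ) 1) ∧
      ∫ y, ψ y ∂(batchOutput C σ s k) = ∫ y, φ y ∂(tensorPow stdNormal m) ∧
      ∫ y, ψ y ∂(batchOutput C σ s' (k + 1)) = ∫ y, φ y ∂(tensorPow (scaledNormal N) m) := by
  obtain ⟨L, hL, hL1, hL2⟩ := exists_projection hC hσ s s' hk
  obtain ⟨a, b, h1, h2⟩ := exists_noise_coeff hkN
  set K : (Fin m → ℝ) × (Fin m → ℝ) → Fin m → ℝ := fun p i => a * p.1 i + b * p.2 i with hK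
  have hKm : Measurable K := by fun_prop
  have hsm : StronglyMeasurable fun x => ∫ z, φ (K (x, z)) ∂(tensorPow stdNormal m) :=
    (hφ.comp hKm).stronglyMeasurable.integral_prod_right'
  -- Averaging `φ` over the added noise gives a deterministic function of the output; by Fubini its
  -- mean is that of `φ` under the noisy law.
  have key : ∀ (ρ : Measure (EuclideanSpace ℝ (Fin (m + 1)))) (μ ν : Measure ℝ)
      [IsProbabilityMeasure μ], ρ.map L = tensorPow μ m →
      (μ.prod stdNormal).map (fun p => a * p.1 + b * p.2) = ν →
      ∫ y, ∫ z, φ (K (L y, z)) ∂(tensorPow stdNormal m) ∂ρ = ∫ y, φ y ∂(tensorPow ν m) := by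
    intro ρ μ ν _ hρ hν
    rw [← integral_map (φ := L) (f := fun x => ∫ z, φ (K (x, z)) ∂(tensorPow stdNormal m))
      hL.aemeasurable hsm.aestronglyMeasurable, hρ,
      ← integral_prod (fun p => φ (K p)) (integrable_test _ (hφ.comp hKm) fun _ => h01 _),
      ← hν, ← tensorPow_prod_map _ _ (by fun_prop),
      integral_map hKm.aemeasurable hφ.aestronglyMeasurable]
  refine ⟨fun x => ∫ z, φ (K (L x, z)) ∂(tensorPow stdNormal m), hsm.measurable.comp hL,
    fun y => ⟨integral_nonneg fun z => (h01 _).1, ?_⟩, key _ _ _ hL1 h1, key _ _ _ hL2 h2⟩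
  have hint : Integrable (fun z => φ (K (L y, z))) (tensorPow stdNormal m) :=
    integrable_test _ (hφ.comp (by fun_prop)) fun _ => h01 _
  refine (integral_mono hint (integrable_const (1 : ℝ)) fun z => (h01 _).2).trans_eq (by simp)

end BatchOutput

end ASGM

namespace ASGM

/-! ### Weights of the indices and the upper bound. -/

lemma weight_nonneg {N : ℕ} {q : ℝ} (hq0 : 0 ≤ q) (hq1 : q ≤ 1) (i : Index N) :
    0 ≤ weight q i := by
  have : 0 ≤ 1 - q := sub_nonneg.2 hq1
  unfold weight
  split_ifs <;> positivity

lemma sum_index {N : ℕ} (F : Index N → ℝ) :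
    ∑ i, F i = ∑ B, F (B, true) + ∑ B, F (B, false) := by
  rw [Fintype.sum_prod_type, ← Finset.sum_add_distrib]
  simp

lemma sum_batch_prob (N : ℕ) (q : ℝ) :
    ∑ B : Finset (Fin N), q ^ B.card * (1 - q) ^ (N - B.card) = 1 := by
  rw [Fin.sum_pow_mul_eq_add_pow]
  simp

lemma sum_weight (N : ℕ) (q : ℝ) : ∑ i : Index N, weight q i = 1 := by
  rw [sum_index]
  simp only [weight, if_true, Bool.false_eq_true, if_false, ← Finset.sum_mul, sum_batch_prob]
  ring

/-- The total mass `q` of selected indices loses `q (1 - q) ^ N`, the empty batch: there both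
divisors are `1`, so there is no change of scale to detect. -/
lemma sum_weight_selected (N : ℕ) (q a b : ℝ) :
    ∑ i : Index N, weight q i * (if i.2 ∧ i.1.Nonempty then a else b) =
      (q - q * (1 - q) ^ N) * a + (1 - q + q * (1 - q) ^ N) * b := by
  have h : ∀ B : Finset (Fin N), weight q (B, true) * (if B.Nonempty then a else b) =
      q ^ B.card * (1 - q) ^ (N - B.card) * (q * a)
        + if B = ∅ then (1 - q) ^ N * q * (b - a) else 0 := by
    intro B
    rcases B.eq_empty_or_nonempty with rfl | hB
    · simp [weight]; ring
    · simp [weight, hB, hB.ne_empty]; ring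
  rw [sum_index]
  simp only [true_and, Bool.false_eq_true, false_and, if_false, h, Finset.sum_add_distrib,
    ← Finset.sum_mul, sum_batch_prob, Finset.sum_ite_eq', Finset.mem_univ, if_true]
  simp only [weight, Bool.false_eq_true, if_false, ← Finset.sum_mul, sum_batch_prob]
  ring

variable {𝒳 : Type*} {n N : ℕ}

instance (C σ : ℝ) (g : 𝒳 → EuclideanSpace ℝ (Fin n)) (D : Fin N → 𝒳) (i : Index N) :
    IsProbabilityMeasure (compD C σ g D i) := by
  unfold compD; infer_instance

instance (C σ : ℝ) (g : 𝒳 → EuclideanSpace ℝ (Fin n)) (D : Fin N → 𝒳) (d : 𝒳) (i : Index N) :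
    IsProbabilityMeasure (compD' C σ g D d i) := by
  unfold compD'; split_ifs <;> infer_instance

lemma compD'_absolutelyContinuous {C σ : ℝ} (hC : 0 < C) (hσ : 0 < σ)
    (g : 𝒳 → EuclideanSpace ℝ (Fin n)) (D : Fin N → 𝒳) (d : 𝒳) (i : Index N) :
    compD' C σ g D d i ≪ compD C σ g D i := by
  unfold compD' compD
  split_ifs <;> exact batchOutput_absolutelyContinuous hC hσ _ _ _ _

lemma exists_test_index {m : ℕ} {C σ : ℝ} (hC : 0 < C) (hσ : 0 < σ)
    (g : 𝒳 → EuclideanSpace ℝ (Fin (m + 1))) (D : Fin N → 𝒳) (d : 𝒳) {α : ℝ}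
    (hα : α ∈ Set.Icc (0 : ℝ) 1) {φ : (Fin m → ℝ) → ℝ} (hφ : Measurable φ)
    (h01 : ∀ y, φ y ∈ Set.Icc (0 : ℝ) 1) (hle : ∫ y, φ y ∂(tensorPow stdNormal m) ≤ α)
    (i : Index N) :
    ∃ ψ : EuclideanSpace ℝ (Fin (m + 1)) → ℝ, Measurable ψ ∧ (∀ y, ψ y ∈ Set.Icc (0 : ℝ) 1) ∧
      ∫ y, ψ y ∂(compD C σ g D i) ≤ α ∧
      ∫ y, (1 - ψ y) ∂(compD' C σ g D d i) =
        if i.2 ∧ i.1.Nonempty then ∫ y, (1 - φ y) ∂(tensorPow (scaledNormal N) m)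
        else idTradeoff α := by
  by_cases hi : i.2 ∧ i.1.Nonempty
  · obtain ⟨ψ, hψ, h, h1, h2⟩ := exists_test_batchOutput hC hσ
      (∑ j ∈ i.1, clip C (g (D j))) (∑ j ∈ i.1, clip C (g (D j)) + clip C (g d))
      hi.2.card_pos (card_finset_fin_le i.1) hφ h01
    refine ⟨ψ, hψ, h, by rwa [compD, h1], ?_⟩
    rw [if_pos hi, integral_one_sub_test _ hψ h, integral_one_sub_test _ hφ h01, compD',
      if_pos hi.1, h2]
  · refine ⟨fun _ => α, measurable_const, fun _ => hα, by simp, ?_⟩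
    rw [if_neg hi, idTradeoff]
    simp

lemma perPairGuarantee_le_upperBound {m : ℕ} {C σ q : ℝ} (hC : 0 < C) (hσ : 0 < σ) (hq0 : 0 ≤ q)
    (hq1 : q ≤ 1) (g : 𝒳 → EuclideanSpace ℝ (Fin (m + 1))) (D : Fin N → 𝒳) (d : 𝒳) {α : ℝ}
    (hα : α ∈ Set.Icc (0 : ℝ) 1) :
    perPairGuarantee C σ q g D d α ≤ upperBound (m + 1) N q α := by
  have hA : 0 ≤ q - q * (1 - q) ^ N := by
    have : (1 - q) ^ N ≤ 1 := pow_le_one₀ (sub_nonneg.2 hq1) (by linarith)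
    nlinarith
  have hw := weight_nonneg (N := N) hq0 hq1
  -- The nonnegative coefficient moves inside the infimum, so it suffices to compare with one
  -- arbitrary test `φ`.
  rw [upperBound, Nat.add_sub_cancel, ← sub_le_iff_le_add, tradeoff, ← smul_eq_mul (_ - _),
    ← Real.sInf_smul_of_nonneg hA]
  refine le_csInf (tradeoff_set_nonempty hα.1).smul_set ?_
  rintro _ ⟨_, ⟨φ, hφ, h01, hle, rfl⟩, rfl⟩
  choose ψ hψ h h1 h2 using exists_test_index (N := N) hC hσ g D d hα hφ h01 hle
  beta_reduce
  rw [smul_eq_mul, sub_le_iff_le_add, ← sum_weight_selected]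
  simp_rw [← h2]
  refine tradeoff_revealed_le hw _ _ hψ h ?_
  refine (Finset.sum_le_sum fun i _ => mul_le_mul_of_nonneg_left (h1 i) (hw i)).trans_eq ?_
  rw [← Finset.sum_mul, sum_weight, one_mul]

end ASGM

theorem mainTheorem5 {𝒳 : Type*} (n N : ℕ) (hn : 1 ≤ n) (hN : 1 ≤ N)
    (C σ q : ℝ) (hC : 0 < C) (hσ : 0 < σ) (hq0 : 0 ≤ q) (hq1 : q ≤ 1)
    (g : 𝒳 → EuclideanSpace ℝ (Fin n)) (D : Fin N → 𝒳) (d : 𝒳) :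
    (∀ (t : NNReal) (c : ℝ), c ∈ Set.Icc (0 : ℝ) 1 →
      ASGM.perPairGuarantee C σ q g D d
          (∑ i, ASGM.weight q i *
            ASGM.lrLevel (ASGM.compD C σ g D i) (ASGM.compD' C σ g D d i) t c) =
        ∑ i, ASGM.weight q i *
          ASGM.tradeoff (ASGM.compD C σ g D i) (ASGM.compD' C σ g D d i)
            (ASGM.lrLevel (ASGM.compD C σ g D i) (ASGM.compD' C σ g D d i) t c)) ∧
    (∀ α ∈ Set.Icc (0 : ℝ) 1,
      ASGM.perPairGuarantee C σ q g D d α ≤ ASGM.upperBound n N q α) := by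
  refine ⟨fun t c hc => ASGM.tradeoff_revealed_lrLevel (ASGM.weight_nonneg hq0 hq1) _ _
    (ASGM.compD'_absolutelyContinuous hC hσ g D d) t hc, fun α hα => ?_⟩
  obtain ⟨m, rfl⟩ := Nat.exists_eq_add_of_le' hn
  exact ASGM.perPairGuarantee_le_upperBound hC hσ hq0 hq1 g D d hα
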